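/- Let $k\ge 0$, let $H$ be a subgroup of $\mathbb{Z}^k$ of finite index, and let $F=\mathbb{Z}^k/H$, with the discrete topology. Let $\mathbb{Z}^k$ act on the $C^*$-algebra $C(F)$ by translation, $(\tau_m f)(x)=f(x-m)$ for $m\in\mathbb{Z}^k$, $x\in F$, where $m$ acts on $F$ through its class in $\mathbb{Z}^k/H$. Let $C(F)\rtimes_\tau\mathbb{Z}^k$ be the crossed product, that is, the universal $C^*$-algebra generated by a copy of $C(F)$ and a unitary representation $u$ of $\mathbb{Z}^k$ satisfying $\tau_m(f)=u_m f u_m^*$ for all $m\in\mathbb{Z}^k$ and $f\in C(F)$. Then there is an isomorphism of $C^*$-algebras $$C(F)\rtimes_\tau\mathbb{Z}^k\;\cong\;C\bigl(\mathbb{T}^k,M_{|F|}(\mathbb{C})\bigr),$$ where $\mathbb{T}$ is the unit circle in $\mathbb{C}$. -/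

import Mathlib

-- The order on `ℂ` is used by the C⋆-algebra structure of `CStarMatrix n n ℂ`.
open scoped ComplexOrder

noncomputable section

open UniformSpace

section CrossedProduct

variable {A G : Type*} [CStarAlgebra A] [Group G]

/-- The action of `G` on the ring `A` underlying a homomorphism `α : G → Aut A`. -/
abbrev CStarAction (α : G →* (A ≃⋆ₐ[ℂ] A)) : MulSemiringAction G A where
  smul g a := α g a
  one_smul a := by change α 1 a = a; rw [map_one]; rfl
  mul_smul g h a := by change α (g * h) a = α g (α h a); rw [map_mul]; rfl
  smul_zero g := map_zero (α g)
  smul_add g := map_add (α g)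
  smul_one g := map_one (α g)
  smul_mul g := map_mul (α g)

/-- The algebraic crossed product: finitely supported sums `∑ a_g u_g` with `a_g ∈ A`, multiplied
by the rule `(a u_g) (b u_h) = a α_g(b) u_{gh}`. -/
def AlgCrossedProduct (_α : G →* (A ≃⋆ₐ[ℂ] A)) := SkewMonoidAlgebra A G

namespace AlgCrossedProduct

variable (α : G →* (A ≃⋆ₐ[ℂ] A))

instance : Ring (AlgCrossedProduct α) :=
  letI := CStarAction α
  show Ring (SkewMonoidAlgebra A G) from inferInstance

instance : Algebra ℂ (AlgCrossedProduct α) :=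
  letI := CStarAction α
  haveI : SMulCommClass G ℂ A := ⟨fun g c a => map_smul (α g) c a⟩
  show Algebra ℂ (SkewMonoidAlgebra A G) from inferInstance

/-- The element `a u_g`. -/
def mono (g : G) : A →ₗ[ℂ] AlgCrossedProduct α where
  toFun a := (SkewMonoidAlgebra.single g a : SkewMonoidAlgebra A G)
  map_add' := SkewMonoidAlgebra.single_add g
  map_smul' c a := (SkewMonoidAlgebra.smul_single c g a).symm

theorem mono_mul_mono (g h : G) (a b : A) :
    mono α g a * mono α h b = mono α (g * h) (a * α g b) :=
  letI := CStarAction α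
  SkewMonoidAlgebra.single_mul_single

theorem mono_one_one : mono α 1 1 = 1 := rfl

theorem algebraMap_eq (c : ℂ) :
    algebraMap ℂ (AlgCrossedProduct α) c = mono α 1 (algebraMap ℂ A c) := by
  rw [Algebra.algebraMap_eq_smul_one, ← mono_one_one, ← map_smul,
    ← Algebra.algebraMap_eq_smul_one]

variable {α}

theorem mono_induction {P : AlgCrossedProduct α → Prop} (x : AlgCrossedProduct α)
    (hm : ∀ g a, P (mono α g a)) (ha : ∀ x y, P x → P y → P (x + y)) : P x :=
  SkewMonoidAlgebra.induction_on (p := P) x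
    ((map_zero (mono α 1)) ▸ hm 1 0) (fun g a => hm g a) (fun {x y} => ha x y)

variable (α)

/-- The involution `(a u_g)* = α_{g⁻¹}(a*) u_{g⁻¹}`, extended additively. -/
def starHom : AlgCrossedProduct α →+ AlgCrossedProduct α :=
  (Finsupp.liftAddHom fun g : G =>
    ((mono α g⁻¹).toAddMonoidHom.comp
      ((α g⁻¹ : A ≃⋆ₐ[ℂ] A) : A →+ A)).comp (starAddEquiv : A ≃+ A).toAddMonoidHom).comp
    (SkewMonoidAlgebra.coeffAddEquiv (k := A) (G := G)).toAddMonoidHom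

theorem starHom_mono (g : G) (a : A) :
    starHom α (mono α g a) = mono α g⁻¹ (α g⁻¹ (star a)) := by
  change Finsupp.liftAddHom _ (Finsupp.single g a) = _
  rw [Finsupp.liftAddHom_apply_single]
  rfl

theorem act_act_inv (g : G) (a : A) : α g (α g⁻¹ a) = a := by
  change (α g * α g⁻¹) a = a
  rw [← map_mul, mul_inv_cancel, map_one]; rfl

theorem act_inv_act (g : G) (a : A) : α g⁻¹ (α g a) = a := by
  simpa using act_act_inv α g⁻¹ a

theorem act_mul (g h : G) (a : A) : α (g * h) a = α g (α h a) := by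
  rw [map_mul]; rfl

instance : StarRing (AlgCrossedProduct α) where
  star := starHom α
  star_involutive x := by
    induction x using mono_induction with
    | hm g a => rw [starHom_mono, starHom_mono, ← map_star, star_star, inv_inv, act_act_inv]
    | ha x y hx hy => rw [map_add, map_add, hx, hy]
  star_mul x y := by
    change starHom α (x * y) = starHom α y * starHom α x
    induction x using mono_induction with
    | ha x x' hx hx' => rw [add_mul, map_add, map_add, mul_add, hx, hx']
    | hm g a =>
      induction y using mono_induction with
      | ha y y' hy hy' => rw [mul_add, map_add, map_add, add_mul, hy, hy']
      | hm h b =>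
        rw [mono_mul_mono, starHom_mono, starHom_mono, starHom_mono, mono_mul_mono, star_mul,
          mul_inv_rev, map_mul (α (h⁻¹ * g⁻¹)), act_mul, act_mul, ← map_star (α g), act_inv_act]
  star_add := map_add (starHom α)

theorem star_mono (g : G) (a : A) :
    star (mono α g a) = mono α g⁻¹ (α g⁻¹ (star a)) := starHom_mono α g a

instance : StarModule ℂ (AlgCrossedProduct α) where
  star_smul c x := by
    induction x using mono_induction with
    | hm g a => rw [← map_smul, star_mono, star_mono, star_smul, map_smul, map_smul]
    | ha x y hx hy => rw [smul_add, star_add, star_add, smul_add, hx, hy]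

/-- The C⋆-seminorms on the algebraic crossed product which are contractive on the copy of `A`
(the last condition is automatic, because `A` is a C⋆-algebra). -/
structure IsCStarSeminorm (p : Seminorm ℂ (AlgCrossedProduct α)) : Prop where
  mul_le : ∀ x y, p (x * y) ≤ p x * p y
  star_mul_self : ∀ x, p (star x * x) = p x ^ 2
  le_norm : ∀ a : A, p (mono α 1 a) ≤ ‖a‖

/-- The universal norm: the supremum of all C⋆-seminorms. -/
def univNorm (x : AlgCrossedProduct α) : ℝ :=
  ⨆ p : {p : Seminorm ℂ (AlgCrossedProduct α) // IsCStarSeminorm α p}, p.1 x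

variable {α}

theorem IsCStarSeminorm.mono_le {p : Seminorm ℂ (AlgCrossedProduct α)} (hp : IsCStarSeminorm α p)
    (g : G) (a : A) : p (mono α g a) ≤ ‖a‖ := by
  have h := hp.star_mul_self (mono α g a)
  rw [star_mono, mono_mul_mono, inv_mul_cancel, ← map_mul] at h
  have h1 := hp.le_norm (α g⁻¹ (star a * a))
  have h2 : ‖α g⁻¹ (star a * a)‖ ≤ ‖a‖ ^ 2 := by
    refine (NonUnitalStarAlgHom.norm_apply_le (α g⁻¹) _).trans ?_
    rw [CStarRing.norm_star_mul_self, sq]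
  exact (sq_le_sq₀ (apply_nonneg p _) (norm_nonneg a)).1 (by linarith)

theorem bddAbove (x : AlgCrossedProduct α) : BddAbove (Set.range
    fun p : {p : Seminorm ℂ (AlgCrossedProduct α) // IsCStarSeminorm α p} => p.1 x) := by
  induction x using mono_induction with
  | hm g a => exact ⟨‖a‖, by rintro _ ⟨p, rfl⟩; exact p.2.mono_le g a⟩
  | ha x y hx hy =>
    obtain ⟨C, hC⟩ := hx
    obtain ⟨D, hD⟩ := hy
    refine ⟨C + D, ?_⟩
    rintro _ ⟨p, rfl⟩
    exact (map_add_le_add p.1 x y).trans (add_le_add (hC ⟨p, rfl⟩) (hD ⟨p, rfl⟩))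

theorem le_univNorm {p : Seminorm ℂ (AlgCrossedProduct α)} (hp : IsCStarSeminorm α p)
    (x : AlgCrossedProduct α) : p x ≤ univNorm α x :=
  le_ciSup (bddAbove x) ⟨p, hp⟩

instance : Nonempty {p : Seminorm ℂ (AlgCrossedProduct α) // IsCStarSeminorm α p} :=
  ⟨0, ⟨fun _ _ => by simp, fun _ => by simp, fun _ => by simp⟩⟩

theorem univNorm_le {x : AlgCrossedProduct α} {C : ℝ}
    (h : ∀ p : Seminorm ℂ (AlgCrossedProduct α), IsCStarSeminorm α p → p x ≤ C) :
    univNorm α x ≤ C :=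
  ciSup_le fun p => h p.1 p.2

theorem univNorm_nonneg (x : AlgCrossedProduct α) : 0 ≤ univNorm α x :=
  Real.iSup_nonneg fun p => apply_nonneg p.1 x

theorem univNorm_mul_le (x y : AlgCrossedProduct α) :
    univNorm α (x * y) ≤ univNorm α x * univNorm α y :=
  univNorm_le fun p hp => (hp.mul_le x y).trans
    (mul_le_mul (le_univNorm hp x) (le_univNorm hp y) (apply_nonneg p y) (univNorm_nonneg x))

theorem univNorm_sq_le (x : AlgCrossedProduct α) :
    univNorm α x * univNorm α x ≤ univNorm α (star x * x) := by
  rw [← sq, ← Real.le_sqrt (univNorm_nonneg x) (univNorm_nonneg _)]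
  refine univNorm_le fun p hp => Real.le_sqrt_of_sq_le ?_
  rw [← hp.star_mul_self]
  exact le_univNorm hp _

variable (α)

/-- The universal norm, as a seminorm. -/
def univSeminorm : Seminorm ℂ (AlgCrossedProduct α) where
  toFun := univNorm α
  map_zero' := le_antisymm (univNorm_le fun p _ => (map_zero p).le) (univNorm_nonneg 0)
  add_le' x y := univNorm_le fun p hp =>
    (map_add_le_add p x y).trans (add_le_add (le_univNorm hp x) (le_univNorm hp y))
  neg' x := iSup_congr fun p => map_neg_eq_map p.1 x
  smul' c x := by
    rw [univNorm, univNorm, Real.mul_iSup_of_nonneg (norm_nonneg c)]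
    exact iSup_congr fun p => map_smul_eq_mul p.1 c x

instance : SeminormedRing (AlgCrossedProduct α) where
  __ := (inferInstance : Ring (AlgCrossedProduct α))
  __ := (univSeminorm α).toAddGroupSeminorm.toSeminormedAddCommGroup
  norm_mul_le := univNorm_mul_le (α := α)

theorem norm_def (x : AlgCrossedProduct α) : ‖x‖ = univNorm α x := rfl

instance : NormedAlgebra ℂ (AlgCrossedProduct α) where
  norm_smul_le c x := (map_smul_eq_mul (univSeminorm α) c x).le

theorem norm_mono_le (g : G) (a : A) : ‖mono α g a‖ ≤ ‖a‖ :=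
  univNorm_le fun _ hp => hp.mono_le g a

theorem norm_star_mul_self_ge (x : AlgCrossedProduct α) : ‖x‖ * ‖x‖ ≤ ‖star x * x‖ :=
  univNorm_sq_le x

instance : NormedStarGroup (AlgCrossedProduct α) where
  norm_star_le x := by
    obtain hx | hx := (norm_nonneg (star x)).eq_or_lt
    · rw [← hx]; exact norm_nonneg x
    · refine le_of_mul_le_mul_right ?_ hx
      simpa using (norm_star_mul_self_ge α (star x)).trans (norm_mul_le _ _)

end AlgCrossedProduct


/-- The crossed product `A ⋊_α G` of a unital C⋆-algebra by an action of a discrete group: the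
completion of the algebraic crossed product in the universal norm. -/
def CrossedProduct (α : G →* (A ≃⋆ₐ[ℂ] A)) := Completion (AlgCrossedProduct α)

namespace CrossedProduct

variable (α : G →* (A ≃⋆ₐ[ℂ] A))

instance : NormedRing (CrossedProduct α) :=
  show NormedRing (Completion (AlgCrossedProduct α)) from inferInstance

instance : CompleteSpace (CrossedProduct α) :=
  show CompleteSpace (Completion (AlgCrossedProduct α)) from inferInstance

instance : NormedAlgebra ℂ (CrossedProduct α) where
  __ := (show Algebra ℂ (Completion (AlgCrossedProduct α)) from inferInstance)
  norm_smul_le := norm_smul_le (β := Completion (AlgCrossedProduct α))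

/-- The canonical map from the algebraic crossed product. -/
def ofAlg : AlgCrossedProduct α →ₐ[ℂ] CrossedProduct α where
  __ := (Completion.coeRingHom : AlgCrossedProduct α →+* Completion (AlgCrossedProduct α))
  commutes' _ := rfl

theorem norm_ofAlg (x : AlgCrossedProduct α) : ‖ofAlg α x‖ = ‖x‖ := Completion.norm_coe x

theorem continuous_ofAlg : Continuous (ofAlg α) := Completion.continuous_coe _

theorem denseRange_ofAlg : DenseRange (ofAlg α) := Completion.denseRange_coe

instance : Star (CrossedProduct α) :=
  ⟨(Completion.map star : Completion (AlgCrossedProduct α) → Completion (AlgCrossedProduct α))⟩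

theorem star_ofAlg (x : AlgCrossedProduct α) : star (ofAlg α x) = ofAlg α (star x) :=
  Completion.map_coe (starₗᵢ ℂ : AlgCrossedProduct α ≃ₗᵢ⋆[ℂ] _).isometry.uniformContinuous x

theorem continuous_star' : Continuous (star : CrossedProduct α → CrossedProduct α) :=
  Completion.continuous_map

variable {α}

@[elab_as_elim]
theorem induction_on {P : CrossedProduct α → Prop} (x : CrossedProduct α)
    (hc : IsClosed {x | P x}) (h : ∀ x, P (ofAlg α x)) : P x :=
  Completion.induction_on x hc h

variable (α)

instance instStarRing : StarRing (CrossedProduct α) where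
  star_involutive x := by
    have := continuous_star' α
    induction x using induction_on with
    | hc => exact isClosed_eq (by fun_prop) (by fun_prop)
    | h x => rw [star_ofAlg, star_ofAlg, star_star]
  star_mul x y := by
    have := continuous_star' α
    induction x using induction_on with
    | hc => exact isClosed_eq (by fun_prop) (by fun_prop)
    | h x =>
      induction y using induction_on with
      | hc => exact isClosed_eq (by fun_prop) (by fun_prop)
      | h y => simp only [star_ofAlg, ← map_mul, star_mul]
  star_add x y := by
    have := continuous_star' α
    induction x using induction_on with
    | hc => exact isClosed_eq (by fun_prop) (by fun_prop)
    | h x =>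
      induction y using induction_on with
      | hc => exact isClosed_eq (by fun_prop) (by fun_prop)
      | h y => simp only [star_ofAlg, ← map_add, star_add]

theorem star_algebraMap (c : ℂ) :
    star (algebraMap ℂ (CrossedProduct α) c) = algebraMap ℂ (CrossedProduct α) (star c) := by
  rw [← AlgHom.commutes (ofAlg α), star_ofAlg, ← AlgHom.commutes (ofAlg α),
    Algebra.algebraMap_eq_smul_one, star_smul, star_one, ← Algebra.algebraMap_eq_smul_one]

instance : StarModule ℂ (CrossedProduct α) where
  star_smul c x := by
    rw [Algebra.smul_def, Algebra.smul_def, star_mul, star_algebraMap, Algebra.commutes]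

instance : CStarAlgebra (CrossedProduct α) where
  __ := (inferInstance : NormedAlgebra ℂ (CrossedProduct α))
  __ := instStarRing α
  star_smul := star_smul
  norm_mul_self_le x := by
    have := continuous_star' α
    induction x using induction_on with
    | hc => exact isClosed_le (by fun_prop) (by fun_prop)
    | h x =>
      rw [star_ofAlg, ← map_mul, norm_ofAlg, norm_ofAlg]
      exact AlgCrossedProduct.norm_star_mul_self_ge α x

/-- The canonical copy of `A` in `A ⋊_α G`. -/
def inclA : A →⋆ₐ[ℂ] CrossedProduct α where
  toFun a := ofAlg α (AlgCrossedProduct.mono α 1 a)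
  map_one' := by rw [AlgCrossedProduct.mono_one_one, map_one]
  map_mul' a b := by
    rw [← map_mul (ofAlg α), AlgCrossedProduct.mono_mul_mono, map_one, one_mul]; rfl
  map_zero' := by rw [map_zero, map_zero]
  map_add' a b := by rw [map_add, map_add]
  commutes' c := by rw [← AlgCrossedProduct.algebraMap_eq, AlgHom.commutes]
  map_star' a := by
    rw [star_ofAlg, AlgCrossedProduct.star_mono, inv_one, map_one]; rfl

theorem mono_one_mul_star (g : G) :
    AlgCrossedProduct.mono α g 1 * star (AlgCrossedProduct.mono α g 1) = 1 := by
  rw [AlgCrossedProduct.star_mono, AlgCrossedProduct.mono_mul_mono, star_one, map_one (α g⁻¹),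
    map_one (α g), mul_one, mul_inv_cancel, AlgCrossedProduct.mono_one_one]

theorem star_mul_mono_one (g : G) :
    star (AlgCrossedProduct.mono α g 1) * AlgCrossedProduct.mono α g 1 = 1 := by
  rw [AlgCrossedProduct.star_mono, AlgCrossedProduct.mono_mul_mono, star_one, map_one (α g⁻¹),
    mul_one, inv_mul_cancel, AlgCrossedProduct.mono_one_one]

/-- The canonical unitary representation of `G` in `A ⋊_α G`. -/
def inclG : G →* unitary (CrossedProduct α) where
  toFun g := ⟨ofAlg α (AlgCrossedProduct.mono α g 1), by
    rw [Unitary.mem_iff, star_ofAlg, ← map_mul (ofAlg α), ← map_mul (ofAlg α),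
      mono_one_mul_star, star_mul_mono_one, map_one]
    exact ⟨rfl, rfl⟩⟩
  map_one' := Subtype.ext (by
    change ofAlg α (AlgCrossedProduct.mono α 1 1) = 1
    rw [AlgCrossedProduct.mono_one_one, map_one])
  map_mul' g h := Subtype.ext (by
    change ofAlg α _ = ofAlg α _ * ofAlg α _
    rw [← map_mul (ofAlg α), AlgCrossedProduct.mono_mul_mono, map_one (α g), one_mul])

theorem covariance (g : G) (a : A) :
    inclA α (α g a) = inclG α g * inclA α a * star (inclG α g : CrossedProduct α) := by
  change ofAlg α _ = ofAlg α _ * ofAlg α _ * star (ofAlg α _)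
  rw [star_ofAlg, AlgCrossedProduct.star_mono, ← map_mul (ofAlg α), ← map_mul (ofAlg α),
    AlgCrossedProduct.mono_mul_mono, AlgCrossedProduct.mono_mul_mono, star_one,
    map_one (α g⁻¹), map_one (α (g * 1)), mul_one, one_mul, mul_one, mul_inv_cancel]

section Universal

variable {α} {B : Type*} [CStarAlgebra B] (π : A →⋆ₐ[ℂ] B) (u : G →* unitary B)

/-- The map `∑ a_g u_g ↦ ∑ π(a_g) u(g)`, as an additive map. -/
def liftAdd : AlgCrossedProduct α →+ B :=
  (Finsupp.liftAddHom fun g : G =>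
    ((AddMonoidHom.mulRight (u g : B)).comp (π : A →+ B))).comp
    (SkewMonoidAlgebra.coeffAddEquiv (k := A) (G := G)).toAddMonoidHom

theorem liftAdd_mono (g : G) (a : A) :
    liftAdd π u (AlgCrossedProduct.mono α g a) = π a * u g := by
  change Finsupp.liftAddHom _ (Finsupp.single g a) = _
  rw [Finsupp.liftAddHom_apply_single]
  rfl

theorem u_inv (g : G) : ((u g⁻¹ : unitary B) : B) = star (u g : B) := by
  rw [map_inv]; rfl

theorem u_mul_pi (h : ∀ g a, π (α g a) = u g * π a * star (u g : B)) (g : G) (a : A) :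
    (u g : B) * π a = π (α g a) * u g := by
  rw [h, mul_assoc, Unitary.coe_star_mul_self, mul_one]

/-- The integrated form of a covariant pair, on the algebraic crossed product. -/
def liftAlg (h : ∀ g a, π (α g a) = u g * π a * star (u g : B)) :
    AlgCrossedProduct α →⋆ₐ[ℂ] B where
  toFun := liftAdd π u
  map_zero' := map_zero _
  map_add' := map_add _
  map_one' := by
    rw [← AlgCrossedProduct.mono_one_one, liftAdd_mono, map_one, map_one]; exact mul_one 1
  map_mul' x y := by
    induction x using AlgCrossedProduct.mono_induction with
    | ha x x' hx hx' => rw [add_mul, map_add, map_add, add_mul, hx, hx']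
    | hm g a =>
      induction y using AlgCrossedProduct.mono_induction with
      | ha y y' hy hy' => rw [mul_add, map_add, map_add, mul_add, hy, hy']
      | hm k b =>
        rw [AlgCrossedProduct.mono_mul_mono, liftAdd_mono, liftAdd_mono, liftAdd_mono, map_mul,
          map_mul, Submonoid.coe_mul, mul_assoc, mul_assoc, ← mul_assoc (u g : B) (π b),
          u_mul_pi π u h, mul_assoc]
  commutes' c := by
    rw [AlgCrossedProduct.algebraMap_eq, liftAdd_mono, map_one, AlgHomClass.commutes]
    exact mul_one _
  map_star' x := by
    induction x using AlgCrossedProduct.mono_induction with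
    | ha x y hx hy => rw [star_add, map_add, map_add, star_add, hx, hy]
    | hm g a =>
      rw [AlgCrossedProduct.star_mono, liftAdd_mono, liftAdd_mono, star_mul, ← map_star π,
        ← u_mul_pi π u h, u_inv]

theorem norm_liftAlg_le (h : ∀ g a, π (α g a) = u g * π a * star (u g : B))
    (x : AlgCrossedProduct α) : ‖liftAlg π u h x‖ ≤ ‖x‖ := by
  refine AlgCrossedProduct.le_univNorm (α := α)
    (p := (normSeminorm ℂ B).comp (liftAlg π u h).toAlgHom.toLinearMap) ⟨?_, ?_, ?_⟩ x
  · intro x y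
    change ‖liftAlg π u h (x * y)‖ ≤ ‖liftAlg π u h x‖ * ‖liftAlg π u h y‖
    rw [map_mul]; exact norm_mul_le _ _
  · intro x
    change ‖liftAlg π u h (star x * x)‖ = ‖liftAlg π u h x‖ ^ 2
    rw [map_mul, map_star, CStarRing.norm_star_mul_self, sq]
  · intro a
    change ‖liftAdd π u (AlgCrossedProduct.mono α 1 a)‖ ≤ ‖a‖
    rw [liftAdd_mono, map_one]
    change ‖π a * 1‖ ≤ ‖a‖
    rw [mul_one]
    exact NonUnitalStarAlgHom.norm_apply_le π a

theorem continuous_liftAlg (h : ∀ g a, π (α g a) = u g * π a * star (u g : B)) :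
    Continuous (liftAlg π u h) :=
  AddMonoidHomClass.continuous_of_bound (liftAlg π u h) 1
    (fun x => by rw [one_mul]; exact norm_liftAlg_le π u h x)

/-- The extension of the integrated form to the crossed product, as a ring homomorphism. -/
def liftRingHom (h : ∀ g a, π (α g a) = u g * π a * star (u g : B)) : CrossedProduct α →+* B :=
  Completion.extensionHom (liftAlg π u h : AlgCrossedProduct α →+* B) (continuous_liftAlg π u h)

theorem liftRingHom_ofAlg (h : ∀ g a, π (α g a) = u g * π a * star (u g : B))
    (x : AlgCrossedProduct α) : liftRingHom π u h (ofAlg α x) = liftAlg π u h x :=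
  Completion.extensionHom_coe (liftAlg π u h : AlgCrossedProduct α →+* B)
    (continuous_liftAlg π u h) x

theorem continuous_liftRingHom (h : ∀ g a, π (α g a) = u g * π a * star (u g : B)) :
    Continuous (liftRingHom π u h) :=
  Completion.continuous_extension

/-- The integrated form of a covariant pair. -/
def lift (h : ∀ g a, π (α g a) = u g * π a * star (u g : B)) : CrossedProduct α →⋆ₐ[ℂ] B where
  __ := liftRingHom π u h
  commutes' c := by
    change liftRingHom π u h (algebraMap ℂ (CrossedProduct α) c) = _
    rw [← AlgHom.commutes (ofAlg α), liftRingHom_ofAlg, AlgHomClass.commutes]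
  map_star' x := by
    change liftRingHom π u h (star x) = star (liftRingHom π u h x)
    have := continuous_liftRingHom π u h
    induction x using induction_on with
    | hc => exact isClosed_eq (this.comp (continuous_star' α)) (continuous_star.comp this)
    | h x => rw [star_ofAlg, liftRingHom_ofAlg, liftRingHom_ofAlg, map_star]

/-- Universal property: every covariant pair `(π, u)` in a C⋆-algebra `B` factors uniquely through
`A ⋊_α G`. -/
theorem existsUnique_lift (h : ∀ g a, π (α g a) = u g * π a * star (u g : B)) :
    ∃! φ : CrossedProduct α →⋆ₐ[ℂ] B,
      (∀ a, φ (inclA α a) = π a) ∧ ∀ g, φ (inclG α g) = u g := by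
  refine ⟨lift π u h, ⟨fun a => ?_, fun g => ?_⟩, fun ψ hψ => ?_⟩
  · change liftRingHom π u h (ofAlg α (AlgCrossedProduct.mono α 1 a)) = _
    rw [liftRingHom_ofAlg]
    change liftAdd π u _ = _
    rw [liftAdd_mono, map_one]; exact mul_one _
  · change liftRingHom π u h (ofAlg α (AlgCrossedProduct.mono α g 1)) = _
    rw [liftRingHom_ofAlg]
    change liftAdd π u _ = _
    rw [liftAdd_mono, map_one, one_mul]
  · refine DFunLike.ext _ _ fun x => ?_
    have h1 : Continuous ψ := AddMonoidHomClass.continuous_of_bound ψ 1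
      (fun y => by rw [one_mul]; exact NonUnitalStarAlgHom.norm_apply_le ψ y)
    have h2 : Continuous (lift π u h) := continuous_liftRingHom π u h
    induction x using induction_on with
    | hc => exact isClosed_eq h1 h2
    | h x =>
      induction x using AlgCrossedProduct.mono_induction with
      | ha x y hx hy => rw [map_add, map_add, map_add, hx, hy]
      | hm g a =>
        have e : ofAlg α (AlgCrossedProduct.mono α g a) = inclA α a * inclG α g := by
          change _ = ofAlg α _ * ofAlg α _
          rw [← map_mul (ofAlg α), AlgCrossedProduct.mono_mul_mono, one_mul, map_one, mul_one]
        rw [e, map_mul, hψ.1, hψ.2, ← e]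
        change _ = liftRingHom π u h _
        rw [liftRingHom_ofAlg]
        exact (liftAdd_mono π u g a).symm

end Universal

end CrossedProduct

end CrossedProduct

/-- The action of `ℤ^k` by translation on `C(F)`, where `F = ℤ^k / H` is a finite quotient of `ℤ^k`
(with its discrete topology): `(τ_m f)(x) = f(x - m)`. -/
def translationAction {k : ℕ} (H : AddSubgroup (Fin k → ℤ)) [Finite ((Fin k → ℤ) ⧸ H)] :
    Multiplicative (Fin k → ℤ) →*
      (C((Fin k → ℤ) ⧸ H, ℂ) ≃⋆ₐ[ℂ] C((Fin k → ℤ) ⧸ H, ℂ)) where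
  toFun m :=
    (Homeomorph.subRight (QuotientAddGroup.mk m.toAdd : (Fin k → ℤ) ⧸ H)).compStarAlgEquiv' ℂ ℂ
  map_one' := by
    ext f x
    change f (x - QuotientAddGroup.mk 0) = f x
    rw [QuotientAddGroup.mk_zero, sub_zero]
  map_mul' m n := by
    ext f x
    change f (x - QuotientAddGroup.mk (m.toAdd + n.toAdd)) =
      f (x - QuotientAddGroup.mk m.toAdd - QuotientAddGroup.mk n.toAdd)
    rw [QuotientAddGroup.mk_add, sub_sub]

end

/-!
Write `F = ℤ^k / H` and choose representatives `s i`, one in each coset. A subgroup `H` of finite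
index is again free of rank `k`; an isomorphism `e : H ≃+ ℤ^k` identifies the points `z` of the torus
with the characters `χ_z` of `H`. Inducing `χ_z` from `H` to `ℤ^k` gives a covariant representation of
`C(F)` and `ℤ^k` on `ℂ^F`: functions act as diagonal matrices, and `m` acts by the matrix whose
`(i, j)` entry is `χ_z (s j + m - s i)`, read as `0` when `s j + m - s i ∉ H`. These matrices depend
continuously on `z`, so the universal property gives a ⋆-homomorphism `toMatrixMaps` from the crossed
product to the continuous matrix-valued functions on the torus.

The inverse rests on two structures inside the crossed product. The unitaries `u_h` with `h ∈ H` are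
central, because `H` acts trivially on `C(F)` and `ℤ^k` is commutative; Gelfand duality for the centre
therefore provides a functional calculus `ψ : C(𝕋^k) → C(F) ⋊ ℤ^k` that sends the character of the
torus given by `e h` to `u_h` (`exists_torus_calculus`). The elements `u_{s i - s j} δ_j`, with `δ_j` the
point mass at the class of `s j`, are matrix units (`isMatrixUnits_crossedMatrixUnit`). Central
functional calculus and matrix units combine to a ⋆-homomorphism `f ↦ ∑ ψ(f_ij) E_ij` on
matrix-valued functions (`matrixUnitsHom`). The two maps are mutually inverse: in one direction this is
checked on the generators of the crossed product, in the other on matrix units and, by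
Stone–Weierstrass, on the characters of the torus.
-/

noncomputable section

/-! ### Characters of the torus and functional calculus -/

section Torus

variable {k : ℕ}

/-- The character `z ↦ ∏ i, z i ^ m i` of the torus, as a complex-valued continuous function. -/
def torusChar (m : Fin k → ℤ) : C(Fin k → Circle, ℂ) where
  toFun z := ((∏ i, z i ^ m i : Circle) : ℂ)
  continuous_toFun := by fun_prop

theorem torusChar_apply (m : Fin k → ℤ) (z : Fin k → Circle) :
    torusChar m z = ((∏ i, z i ^ m i : Circle) : ℂ) := rfl

theorem torusChar_zero : torusChar (0 : Fin k → ℤ) = 1 := by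
  ext z; simp [torusChar_apply]

theorem torusChar_add (m n : Fin k → ℤ) : torusChar (m + n) = torusChar m * torusChar n := by
  ext z; simp [torusChar_apply, zpow_add, Finset.prod_mul_distrib]

theorem star_torusChar (m : Fin k → ℤ) : star (torusChar m) = torusChar (-m) := by
  ext z
  rw [ContinuousMap.star_apply, torusChar_apply, torusChar_apply, ← starRingEnd_apply,
    ← Circle.coe_inv_eq_conj, ← Finset.prod_inv_distrib]
  simp

theorem torusChar_single (i : Fin k) (z : Fin k → Circle) :
    torusChar (Pi.single i 1) z = z i := by
  rw [torusChar_apply, Finset.prod_eq_single i]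
  · simp
  · intro j _ hj; simp [Pi.single_eq_of_ne hj]
  · simp

/-- A homomorphism `θ : ℤ^k → 𝕋` is evaluation at the point of the torus with coordinates `θ(e_i)`. -/
theorem torusChar_eval_hom (θ : Multiplicative (Fin k → ℤ) →* Circle) (m : Fin k → ℤ) :
    torusChar m (fun i => θ (.ofAdd (Pi.single i 1))) = θ (.ofAdd m) := by
  rw [torusChar_apply]
  congr 1
  conv_rhs => rw [← Finset.univ_sum_single m, ofAdd_sum, map_prod]
  refine Finset.prod_congr rfl fun i _ => ?_
  rw [← map_zpow, ← ofAdd_zsmul, ← Pi.single_smul, smul_eq_mul, mul_one]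

/-- The characters separate the points of the torus, so by Stone–Weierstrass they determine a
⋆-homomorphism on `C(𝕋^k)`. -/
theorem starAlgHom_ext_of_torusChar {B : Type*} [CStarAlgebra B]
    {φ ψ : C(Fin k → Circle, ℂ) →⋆ₐ[ℂ] B} (h : ∀ m, φ (torusChar m) = ψ (torusChar m)) :
    φ = ψ := by
  have hcont (χ : C(Fin k → Circle, ℂ) →⋆ₐ[ℂ] B) : Continuous χ :=
    AddMonoidHomClass.continuous_of_bound χ 1 fun f => by
      rw [one_mul]; exact NonUnitalStarAlgHom.norm_apply_le χ f
  have hcl : IsClosed (StarAlgHom.equalizer φ ψ : Set C(Fin k → Circle, ℂ)) :=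
    isClosed_eq (hcont φ) (hcont ψ)
  have htop := ContinuousMap.starSubalgebra_topologicalClosure_eq_top_of_separatesPoints
    (StarAlgHom.equalizer φ ψ) (by
      intro z w hzw
      obtain ⟨i, hi⟩ := Function.ne_iff.1 hzw
      refine ⟨_, ⟨torusChar (Pi.single i 1), h _, rfl⟩, ?_⟩
      change torusChar (Pi.single i 1) z ≠ torusChar (Pi.single i 1) w
      rw [torusChar_single, torusChar_single]
      exact fun h => hi (Circle.ext h))
  refine StarAlgHom.ext fun f => ?_
  have hf : f ∈ (StarAlgHom.equalizer φ ψ).topologicalClosure := htop ▸ StarSubalgebra.mem_top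
  rw [← SetLike.mem_coe, StarSubalgebra.topologicalClosure_coe, hcl.closure_eq] at hf
  exact hf

/-- Functional calculus for central unitaries: a representation of `ℤ^k` by central unitaries of `A`
extends to a ⋆-homomorphism from `C(𝕋^k)` to the centre of `A`. It is the pullback along the map
from the character space of the centre to the torus, followed by the inverse Gelfand transform. -/
theorem exists_torus_calculus {A : Type*} [CStarAlgebra A]
    (v : Multiplicative (Fin k → ℤ) →* unitary A) (hv : ∀ m a, Commute (v m : A) a) :
    ∃ ψ : C(Fin k → Circle, ℂ) →⋆ₐ[ℂ] A, (∀ f a, Commute (ψ f) a) ∧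
      ∀ m, ψ (torusChar m) = v (.ofAdd m) := by
  -- `D` is the centre of `A`, a commutative C⋆-algebra.
  let D : StarSubalgebra ℂ A := StarSubalgebra.centralizer ℂ Set.univ
  have hD : IsClosed (D : Set A) := by
    rw [StarSubalgebra.coe_centralizer]; exact Set.isClosed_centralizer _
  have hmem : ∀ {a : A}, a ∈ D ↔ ∀ b, Commute a b := by
    intro a
    rw [StarSubalgebra.mem_centralizer_iff]
    exact ⟨fun h b => ((h b trivial).1).symm,
      fun h b _ => ⟨(h b).symm, (h (star b)).symm⟩⟩
  let _ : CommRing D := { (inferInstance : Ring D) with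
    mul_comm := fun a b => Subtype.ext (hmem.1 a.2 b) }
  let _ : CommCStarAlgebra D := { (inferInstance : CStarAlgebra D) with
    mul_comm := fun a b => Subtype.ext (hmem.1 a.2 b) }
  let w : Multiplicative (Fin k → ℤ) →* D :=
    { toFun := fun m => ⟨v m, hmem.2 (hv m)⟩
      map_one' := Subtype.ext (by simp)
      map_mul' := fun m n => Subtype.ext (by simp) }
  have hw : ∀ m, star (w m) * w m = 1 := fun m => Subtype.ext (Unitary.coe_star_mul_self (v m))
  -- Characters of the centre take values in the circle on the given unitaries.
  have hnorm (φ : WeakDual.characterSpace ℂ D) (m) : φ (w m) ∈ Submonoid.unitSphere ℂ := by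
    have h := congrArg φ (hw m)
    rw [map_mul, map_star, map_one, ← starRingEnd_apply, ← Complex.normSq_eq_conj_mul_self,
      Complex.ofReal_eq_one, Complex.normSq_eq_norm_sq] at h
    exact mem_sphere_zero_iff_norm.2 ((pow_eq_one_iff_of_nonneg (norm_nonneg _) two_ne_zero).1 h)
  let θ (φ : WeakDual.characterSpace ℂ D) : Multiplicative (Fin k → ℤ) →* Circle :=
    { toFun := fun m => ⟨φ (w m), hnorm φ m⟩
      map_one' := Circle.ext (by simp)
      map_mul' := fun m n => Circle.ext ((congrArg φ (map_mul w m n)).trans (map_mul φ _ _)) }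
  let κ : C(WeakDual.characterSpace ℂ D, Fin k → Circle) :=
    { toFun := fun φ i => θ φ (.ofAdd (Pi.single i 1))
      continuous_toFun := by
        refine continuous_pi fun i => Continuous.subtype_mk ?_ _
        exact (map_continuous (gelfandStarTransform D (w (.ofAdd (Pi.single i 1))))) }
  refine ⟨D.subtype.comp (((gelfandStarTransform D).symm : _ →⋆ₐ[ℂ] D).comp
    (κ.compStarAlgHom' ℂ ℂ)), fun f a => hmem.1 (Subtype.prop _) a, fun m => ?_⟩
  have : κ.compStarAlgHom' ℂ ℂ (torusChar m) = gelfandStarTransform D (w (.ofAdd m)) := by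
    ext φ
    exact torusChar_eval_hom (θ φ) m
  change (((gelfandStarTransform D).symm (κ.compStarAlgHom' ℂ ℂ (torusChar m)) : D) : A) = _
  rw [this, StarAlgEquiv.symm_apply_apply]
  rfl

end Torus

/-! ### Matrix-valued functions and matrix units -/

section MatrixUnits

/-- The continuous functions on `X` with values in the matrices over `ℂ`. This is a type synonym of
`C(X, CStarMatrix ι ι ℂ)` whose only algebraic structure is the one coming from its C⋆-algebra
structure, so that instances are found along a single path. -/
def MatrixMaps (X ι : Type*) [TopologicalSpace X] := C(X, CStarMatrix ι ι ℂ)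

instance (X ι : Type*) [TopologicalSpace X] [CompactSpace X] [Fintype ι] [DecidableEq ι] :
    CStarAlgebra (MatrixMaps X ι) :=
  inferInstanceAs (CStarAlgebra C(X, CStarMatrix ι ι ℂ))

variable {X ι : Type*} [TopologicalSpace X]

/-- The matrix-valued function with given entries. -/
def matrixMap (g : ι → ι → C(X, ℂ)) : MatrixMaps X ι where
  toFun z := CStarMatrix.ofMatrix fun i j => g i j z
  continuous_toFun := continuous_pi fun i => continuous_pi fun j => map_continuous (g i j)

/-- The `(i, j)` entry of a matrix-valued function, as a scalar-valued function. -/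
def entry (f : MatrixMaps X ι) (i j : ι) : C(X, ℂ) where
  toFun z := (show C(X, CStarMatrix ι ι ℂ) from f) z i j
  continuous_toFun := (continuous_apply_apply (ρ := fun _ _ => ℂ) i j).comp
    (map_continuous (show C(X, CStarMatrix ι ι ℂ) from f))

theorem entry_matrixMap (g : ι → ι → C(X, ℂ)) (i j : ι) : entry (matrixMap g) i j = g i j := rfl

theorem entry_ext {f g : MatrixMaps X ι} (h : ∀ i j, entry f i j = entry g i j) :
    f = g :=
  ContinuousMap.ext fun z => CStarMatrix.ext fun i j =>
    congrArg (fun F : C(X, ℂ) => F z) (h i j)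

variable [CompactSpace X] [Fintype ι] [DecidableEq ι]

theorem entry_add (f g : MatrixMaps X ι) (i j : ι) :
    entry (f + g) i j = entry f i j + entry g i j := rfl

theorem entry_zero (i j : ι) : entry (0 : MatrixMaps X ι) i j = 0 := rfl

theorem entry_mul (f g : MatrixMaps X ι) (i j : ι) :
    entry (f * g) i j = ∑ l, entry f i l * entry g l j := by
  ext z
  rw [ContinuousMap.sum_apply]
  exact CStarMatrix.mul_apply

theorem entry_star (f : MatrixMaps X ι) (i j : ι) :
    entry (star f) i j = star (entry f j i) := rfl

theorem entry_one (i j : ι) :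
    entry (1 : MatrixMaps X ι) i j = if i = j then 1 else 0 := by
  ext z
  refine (CStarMatrix.one_apply (A := ℂ)).trans ?_
  split_ifs <;> rfl

theorem entry_smul (c : ℂ) (f : MatrixMaps X ι) (i j : ι) :
    entry (c • f) i j = c • entry f i j := rfl

theorem entry_sum {κ : Type*} (t : Finset κ) (f : κ → MatrixMaps X ι) (i j : ι) :
    entry (∑ l ∈ t, f l) i j = ∑ l ∈ t, entry (f l) i j :=
  map_sum (AddMonoidHom.mk' (fun f : MatrixMaps X ι => entry f i j)
    fun f g => entry_add f g i j) f t

/-- The embedding of the scalar-valued functions as multiples of the identity matrix. -/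
def scalarMap : C(X, ℂ) →⋆ₐ[ℂ] MatrixMaps X ι where
  toFun f := matrixMap fun i j => if i = j then f else 0
  map_one' := entry_ext fun i j => by rw [entry_matrixMap, entry_one]
  map_mul' f g := entry_ext fun i j => by simp [entry_matrixMap, entry_mul]
  map_zero' := entry_ext fun i j => by rw [entry_matrixMap, ite_self, entry_zero]
  map_add' f g := entry_ext fun i j => by
    simp only [entry_matrixMap, entry_add]; split_ifs <;> simp
  commutes' c := entry_ext fun i j => by
    rw [entry_matrixMap, Algebra.algebraMap_eq_smul_one, Algebra.algebraMap_eq_smul_one,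
      entry_smul, entry_one, smul_ite]
    congr 1
    exact (smul_zero (A := C(X, ℂ)) c).symm
  map_star' f := entry_ext fun i j => by
    rw [entry_matrixMap, entry_star, entry_matrixMap, apply_ite star, star_zero]
    simp only [eq_comm]

theorem entry_scalarMap (f : C(X, ℂ)) (i j : ι) :
    entry (scalarMap f : MatrixMaps X ι) i j = if i = j then f else 0 := rfl

variable {A : Type*} [CStarAlgebra A]

/-- `E` is a full system of matrix units in `A`, indexed by `ι`. -/
structure IsMatrixUnits (E : ι → ι → A) : Prop where
  mul_eq : ∀ i j l m, E i j * E l m = if j = l then E i m else 0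
  star_eq : ∀ i j, star (E i j) = E j i
  sum_eq : ∑ i, E i i = 1

/-- The ⋆-homomorphism `f ↦ ∑ ψ(f_ij) E_ij` on matrix-valued functions, given by a ⋆-homomorphism
`ψ` from the scalar-valued functions to the centre of `A` and matrix units `E` in `A`. -/
def matrixUnitsHom (ψ : C(X, ℂ) →⋆ₐ[ℂ] A) (hψ : ∀ f a, Commute (ψ f) a) {E : ι → ι → A}
    (hE : IsMatrixUnits E) : MatrixMaps X ι →⋆ₐ[ℂ] A :=
  have hone : ∑ i, ∑ j, ψ (entry (1 : MatrixMaps X ι) i j) * E i j = 1 := by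
    simp [entry_one, apply_ite ψ, hE.sum_eq]
  { toFun f := ∑ i, ∑ j, ψ (entry f i j) * E i j
    map_one' := hone
    map_mul' f g := by
      have key : ∀ i j l m, ψ (entry f i j) * E i j * (ψ (entry g l m) * E l m) =
          if j = l then ψ (entry f i j) * ψ (entry g l m) * E i m else 0 := by
        intro i j l m
        rw [mul_assoc, ← mul_assoc (E i j), ← (hψ _ (E i j)).eq, mul_assoc, hE.mul_eq,
          ← mul_assoc, mul_ite, mul_zero]
      -- The `(i, j)` summand of the first factor meets only row `j` of the second.
      have row : ∀ i j, ψ (entry f i j) * E i j * ∑ l, ∑ m, ψ (entry g l m) * E l m =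
          ∑ m, ψ (entry f i j) * ψ (entry g j m) * E i m := by
        intro i j
        simp only [Finset.mul_sum, key]
        rw [Finset.sum_comm]
        simp
      simp only [Finset.sum_mul, row, entry_mul, map_sum, map_mul]
      exact Finset.sum_congr rfl fun i _ => Finset.sum_comm
    map_zero' := by
      simp [entry_zero]
    map_add' f g := by simp [entry_add, add_mul, Finset.sum_add_distrib]
    commutes' c := by
      simp only [Algebra.algebraMap_eq_smul_one, entry_smul, map_smul, smul_mul_assoc,
        ← Finset.smul_sum, hone]
    map_star' f := by
      simp only [star_sum, star_mul, hE.star_eq, entry_star, map_star]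
      rw [Finset.sum_comm]
      refine Finset.sum_congr rfl fun i _ => Finset.sum_congr rfl fun j _ => ?_
      rw [← map_star, (hψ _ _).eq] }

theorem matrixUnitsHom_apply (ψ : C(X, ℂ) →⋆ₐ[ℂ] A) (hψ : ∀ f a, Commute (ψ f) a) {E : ι → ι → A}
    (hE : IsMatrixUnits E) (f : MatrixMaps X ι) :
    matrixUnitsHom ψ hψ hE f = ∑ i, ∑ j, ψ (entry f i j) * E i j := rfl

end MatrixUnits

/-! ### Generators of the crossed product -/

namespace CrossedProduct

theorem ofAlg_mono {A G : Type*} [CStarAlgebra A] [Group G] (α : G →* (A ≃⋆ₐ[ℂ] A)) (g : G)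
    (a : A) : ofAlg α (AlgCrossedProduct.mono α g a) = inclA α a * inclG α g := by
  change _ = ofAlg α _ * ofAlg α _
  rw [← map_mul (ofAlg α), AlgCrossedProduct.mono_mul_mono, one_mul, map_one, mul_one]

/-- An element that commutes with the generators of the crossed product is central. -/
theorem commute_of_generators {A G : Type*} [CStarAlgebra A] [Group G] {α : G →* (A ≃⋆ₐ[ℂ] A)}
    {z : CrossedProduct α} (hA : ∀ a, Commute z (inclA α a))
    (hG : ∀ g, Commute z (inclG α g : CrossedProduct α)) (x : CrossedProduct α) :
    Commute z x := by
  induction x using induction_on with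
  | hc => exact isClosed_eq (continuous_const_mul z) (continuous_mul_const z)
  | h x =>
    induction x using AlgCrossedProduct.mono_induction with
    | ha x y hx hy => rw [map_add]; exact hx.add_right hy
    | hm g a => rw [ofAlg_mono]; exact (hA a).mul_right (hG g)

end CrossedProduct

/-! ### The covariant pair of induced representations -/

section Translation

variable {k : ℕ} {H : AddSubgroup (Fin k → ℤ)}

open scoped Classical in
/-- For `x ∈ H`, the function `z ↦ χ_z(x)` on the torus, where `χ_z` is the character of `H ≅ ℤ^k`
with parameter `z`; extended by zero to all of `ℤ^k`. -/
def subgroupChar (e : H ≃+ (Fin k → ℤ)) (x : Fin k → ℤ) : C(Fin k → Circle, ℂ) :=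
  if h : x ∈ H then torusChar (e ⟨x, h⟩) else 0

variable (e : H ≃+ (Fin k → ℤ))

theorem subgroupChar_of_mem {x : Fin k → ℤ} (h : x ∈ H) :
    subgroupChar e x = torusChar (e ⟨x, h⟩) := dif_pos h

theorem subgroupChar_of_notMem {x : Fin k → ℤ} (h : x ∉ H) : subgroupChar e x = 0 := dif_neg h

theorem subgroupChar_zero : subgroupChar e 0 = 1 := by
  rw [subgroupChar_of_mem e H.zero_mem, ← torusChar_zero]
  exact congrArg torusChar (map_zero e)

/-- One argument in `H` suffices: if the other is not, then neither is the sum, and both sides vanish. -/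
theorem subgroupChar_mul {x y : Fin k → ℤ} (hy : y ∈ H) :
    subgroupChar e x * subgroupChar e y = subgroupChar e (x + y) := by
  by_cases hx : x ∈ H
  · rw [subgroupChar_of_mem e hx, subgroupChar_of_mem e hy, ← torusChar_add, ← map_add,
      subgroupChar_of_mem e (H.add_mem hx hy)]
    rfl
  · rw [subgroupChar_of_notMem e hx, zero_mul, subgroupChar_of_notMem]
    rwa [H.add_mem_cancel_right hy]

theorem star_subgroupChar (x : Fin k → ℤ) : star (subgroupChar e x) = subgroupChar e (-x) := by
  by_cases hx : x ∈ H
  · rw [subgroupChar_of_mem e hx, subgroupChar_of_mem e (H.neg_mem hx), star_torusChar, ← map_neg]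
    rfl
  · rw [subgroupChar_of_notMem e hx, star_zero, subgroupChar_of_notMem]
    rwa [H.neg_mem_iff]

variable {ι : Type*} {s : ι → Fin k → ℤ}
  (hs : Function.Bijective fun i => (s i : (Fin k → ℤ) ⧸ H))

include hs in
theorem sub_mem_iff_eq {i j : ι} : s i - s j ∈ H ↔ i = j := by
  rw [← hs.1.eq_iff (a := i) (b := j), eq_comm, QuotientAddGroup.eq, neg_add_eq_sub]

include hs in
theorem exists_sub_mem (x : Fin k → ℤ) : ∃ i, x - s i ∈ H := by
  obtain ⟨i, hi⟩ := hs.2 x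
  exact ⟨i, by rwa [QuotientAddGroup.eq, neg_add_eq_sub] at hi⟩

include hs in
theorem subgroupChar_sub [DecidableEq ι] (i j : ι) :
    subgroupChar e (s i - s j) = if i = j then 1 else 0 := by
  split_ifs with h
  · rw [h, sub_self, subgroupChar_zero]
  · exact subgroupChar_of_notMem e (by rwa [sub_mem_iff_eq hs])

variable (s) in
/-- The matrices by which `m ∈ ℤ^k` acts in the representations induced from the characters of `H`,
in the basis indexed by the coset representatives `s`: the `(i, j)` entry at `z` is
`χ_z(s j + m - s i)`, which vanishes unless `s i` lies in the coset of `s j + m`. -/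
def translationMatrix (m : Fin k → ℤ) : MatrixMaps (Fin k → Circle) ι :=
  matrixMap fun i j => subgroupChar e (s j + m - s i)

theorem entry_translationMatrix (m : Fin k → ℤ) (i j : ι) :
    entry (translationMatrix e s m) i j = subgroupChar e (s j + m - s i) := rfl

variable [Fintype ι] [DecidableEq ι]

theorem star_translationMatrix (m : Fin k → ℤ) :
    star (translationMatrix e s m) = translationMatrix e s (-m) := by
  refine entry_ext fun i j => ?_
  rw [entry_star, entry_translationMatrix, entry_translationMatrix, star_subgroupChar]
  congr 1
  abel

include hs in
theorem translationMatrix_mul (m n : Fin k → ℤ) :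
    translationMatrix e s m * translationMatrix e s n = translationMatrix e s (m + n) := by
  refine entry_ext fun i j => ?_
  obtain ⟨l, hl⟩ := exists_sub_mem hs (s j + n)
  rw [entry_mul, Finset.sum_eq_single l]
  · rw [entry_translationMatrix, entry_translationMatrix, subgroupChar_mul e hl,
      entry_translationMatrix]
    congr 1
    abel
  · intro l' _ hne
    rw [entry_translationMatrix e n, subgroupChar_of_notMem, mul_zero]
    intro h
    have := H.sub_mem hl h
    rw [sub_sub_sub_cancel_left, sub_mem_iff_eq hs] at this
    exact hne this
  · exact fun h => absurd (Finset.mem_univ l) h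

include hs in
theorem translationMatrix_zero : translationMatrix e s 0 = 1 := by
  refine entry_ext fun i j => ?_
  rw [entry_translationMatrix, entry_one, add_zero, subgroupChar_sub e hs]
  simp only [eq_comm]

/-- The unitary representation of `ℤ^k` by the matrices `translationMatrix`. -/
def translationUnitary : Multiplicative (Fin k → ℤ) →*
    unitary (MatrixMaps (Fin k → Circle) ι) where
  toFun m := ⟨translationMatrix e s m.toAdd, by
    rw [Unitary.mem_iff, star_translationMatrix, translationMatrix_mul e hs,
      translationMatrix_mul e hs, neg_add_cancel, add_neg_cancel, translationMatrix_zero e hs]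
    exact ⟨rfl, rfl⟩⟩
  map_one' := Subtype.ext (translationMatrix_zero e hs)
  map_mul' m n := Subtype.ext (translationMatrix_mul e hs m.toAdd n.toAdd).symm

theorem coe_translationUnitary (m : Multiplicative (Fin k → ℤ)) :
    (translationUnitary e hs m : MatrixMaps (Fin k → Circle) ι) =
      translationMatrix e s m.toAdd := rfl

variable (s) in
/-- The representation of `C(F)` by constant diagonal matrices with entries `f (s i)`. -/
def diagonalHom (X : Type*) [TopologicalSpace X] [CompactSpace X] :
    C((Fin k → ℤ) ⧸ H, ℂ) →⋆ₐ[ℂ] MatrixMaps X ι where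
  toFun f := matrixMap fun i j => if i = j then .const X (f (s i)) else 0
  map_one' := entry_ext fun i j => by rw [entry_matrixMap, entry_one]; rfl
  map_mul' f g := entry_ext fun i j => by
    simp only [entry_matrixMap, entry_mul, ite_mul, zero_mul, Finset.sum_ite_eq, Finset.mem_univ,
      if_true]
    split_ifs
    · rfl
    · rw [mul_zero]
  map_zero' := entry_ext fun i j => by
    rw [entry_matrixMap]; exact ite_self _
  map_add' f g := entry_ext fun i j => by
    simp only [entry_matrixMap, entry_add]; split_ifs
    · rfl
    · rw [add_zero]
  commutes' c := entry_ext fun i j => by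
    rw [entry_matrixMap, Algebra.algebraMap_eq_smul_one, Algebra.algebraMap_eq_smul_one,
      entry_smul, entry_one, smul_ite]
    congr 1
    exact (smul_zero (A := C(X, ℂ)) c).symm
  map_star' f := entry_ext fun i j => by
    rw [entry_matrixMap, entry_star, entry_matrixMap]
    by_cases h : i = j
    · subst h; simp only [if_true]; rfl
    · rw [if_neg h, if_neg (Ne.symm h), star_zero]

theorem entry_diagonalHom {X : Type*} [TopologicalSpace X] [CompactSpace X]
    (f : C((Fin k → ℤ) ⧸ H, ℂ)) (i j : ι) :
    entry (diagonalHom s X f) i j = if i = j then .const X (f (s i)) else 0 := rfl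

variable [Finite ((Fin k → ℤ) ⧸ H)]

theorem translationAction_apply (m : Multiplicative (Fin k → ℤ)) (f : C((Fin k → ℤ) ⧸ H, ℂ))
    (x : (Fin k → ℤ) ⧸ H) : translationAction H m f x = f (x - (m.toAdd : Fin k → ℤ)) := rfl

theorem diagonalHom_covariant (m : Multiplicative (Fin k → ℤ)) (f : C((Fin k → ℤ) ⧸ H, ℂ)) :
    diagonalHom s (Fin k → Circle) (translationAction H m f) =
      translationUnitary e hs m * diagonalHom s (Fin k → Circle) f *
        star (translationUnitary e hs m : MatrixMaps (Fin k → Circle) ι) := by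
  -- It suffices to prove the intertwining relation without the inverse of the unitary.
  have h : diagonalHom s (Fin k → Circle) (translationAction H m f) *
      (translationUnitary e hs m : MatrixMaps (Fin k → Circle) ι) =
      translationUnitary e hs m * diagonalHom s (Fin k → Circle) f := by
    refine entry_ext fun i j => ?_
    simp only [entry_mul, entry_diagonalHom, coe_translationUnitary, entry_translationMatrix,
      ite_mul, zero_mul, mul_ite, mul_zero, Finset.sum_ite_eq, Finset.sum_ite_eq', Finset.mem_univ,
      if_true]
    by_cases hm : s j + m.toAdd - s i ∈ H
    · have : ((s i : (Fin k → ℤ) ⧸ H) - (m.toAdd : Fin k → ℤ)) = s j := by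
        rw [← QuotientAddGroup.mk_sub, QuotientAddGroup.eq]
        convert hm using 1
        abel
      rw [translationAction_apply, this, mul_comm]
    · rw [subgroupChar_of_notMem e hm, mul_zero, zero_mul]
  rw [← h, mul_assoc, Unitary.mul_star_self_of_mem (translationUnitary e hs m).2, mul_one]

/-- The integrated form of the covariant pair `(diagonalHom, translationUnitary)`. -/
def toMatrixMaps : CrossedProduct (translationAction H) →⋆ₐ[ℂ]
    MatrixMaps (Fin k → Circle) ι :=
  CrossedProduct.lift (diagonalHom s _) (translationUnitary e hs) (diagonalHom_covariant e hs)

theorem toMatrixMaps_inclA (f : C((Fin k → ℤ) ⧸ H, ℂ)) :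
    toMatrixMaps e hs (CrossedProduct.inclA _ f) = diagonalHom s _ f := by
  change CrossedProduct.liftRingHom _ _ _ (CrossedProduct.ofAlg _ _) = _
  rw [CrossedProduct.liftRingHom_ofAlg]
  change CrossedProduct.liftAdd _ _ _ = _
  rw [CrossedProduct.liftAdd_mono, map_one]
  exact mul_one _

theorem toMatrixMaps_inclG (m : Multiplicative (Fin k → ℤ)) :
    toMatrixMaps e hs (CrossedProduct.inclG (translationAction H) m) =
      translationMatrix e s m.toAdd := by
  change CrossedProduct.liftRingHom _ _ _ (CrossedProduct.ofAlg _ _) = _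
  rw [CrossedProduct.liftRingHom_ofAlg]
  change CrossedProduct.liftAdd _ _ _ = _
  rw [CrossedProduct.liftAdd_mono, map_one, one_mul]
  rfl

end Translation

/-! ### Matrix units in the crossed product and the inverse map -/

section Inverse

open CrossedProduct

variable {k : ℕ} {H : AddSubgroup (Fin k → ℤ)}

open scoped Classical in
/-- The indicator function of a point `x` of `F`. -/
def pointMass [Finite ((Fin k → ℤ) ⧸ H)] (x : (Fin k → ℤ) ⧸ H) : C((Fin k → ℤ) ⧸ H, ℂ) where
  toFun y := if y = x then 1 else 0
  continuous_toFun := continuous_of_discreteTopology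

variable [Finite ((Fin k → ℤ) ⧸ H)] {ι : Type*} {s : ι → Fin k → ℤ}
  (hs : Function.Bijective fun i => (s i : (Fin k → ℤ) ⧸ H))

open scoped Classical in
theorem pointMass_apply (x y : (Fin k → ℤ) ⧸ H) : pointMass x y = if y = x then 1 else 0 := rfl

include hs in
theorem pointMass_apply_rep [DecidableEq ι] (i j : ι) :
    pointMass (s j : (Fin k → ℤ) ⧸ H) (s i) = if i = j then 1 else 0 := by
  classical
  rw [pointMass_apply]
  exact if_congr hs.1.eq_iff rfl rfl

theorem star_pointMass (x : (Fin k → ℤ) ⧸ H) : star (pointMass x) = pointMass x := by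
  ext y
  rw [ContinuousMap.star_apply, pointMass_apply]
  split_ifs <;> simp

include hs in
theorem pointMass_mul [DecidableEq ι] (i j : ι) :
    pointMass (s i : (Fin k → ℤ) ⧸ H) * pointMass (s j : (Fin k → ℤ) ⧸ H) =
      if i = j then pointMass (s i : (Fin k → ℤ) ⧸ H) else 0 := by
  ext y
  obtain ⟨l, rfl⟩ := hs.2 y
  rw [ContinuousMap.mul_apply, pointMass_apply_rep hs, pointMass_apply_rep hs]
  by_cases h : i = j
  · subst h
    rw [if_pos rfl, pointMass_apply_rep hs]
    split_ifs <;> simp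
  · rw [if_neg h]
    by_cases hl : l = i
    · subst hl; simp [h]
    · simp [hl]

include hs in
theorem sum_smul_pointMass [Fintype ι] (f : C((Fin k → ℤ) ⧸ H, ℂ)) :
    ∑ i, f (s i) • pointMass (s i : (Fin k → ℤ) ⧸ H) = f := by
  classical
  ext y
  obtain ⟨l, rfl⟩ := hs.2 y
  simp [ContinuousMap.sum_apply, pointMass_apply_rep hs]

theorem translationAction_pointMass (m : Fin k → ℤ) (x : (Fin k → ℤ) ⧸ H) :
    translationAction H (.ofAdd m) (pointMass x) =
      pointMass (x + (m : (Fin k → ℤ) ⧸ H)) := by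
  classical
  ext y
  rw [translationAction_apply, pointMass_apply, pointMass_apply]
  exact if_congr sub_eq_iff_eq_add rfl rfl

variable (H) in
/-- The canonical unitary `u_m` of the crossed product, with `m` written additively. -/
def groupElt (m : Fin k → ℤ) : CrossedProduct (translationAction H) :=
  inclG (translationAction H) (.ofAdd m)

variable (H) in
theorem groupElt_zero : groupElt H 0 = 1 := by
  rw [groupElt, ofAdd_zero, map_one]; rfl

variable (H) in
theorem groupElt_add (m n : Fin k → ℤ) : groupElt H (m + n) = groupElt H m * groupElt H n := by
  rw [groupElt, ofAdd_add, map_mul]; rfl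

variable (H) in
theorem star_groupElt (m : Fin k → ℤ) : star (groupElt H m) = groupElt H (-m) := by
  rw [groupElt, groupElt, ofAdd_neg, map_inv]; rfl

theorem groupElt_mul_inclA (m : Fin k → ℤ) (f : C((Fin k → ℤ) ⧸ H, ℂ)) :
    groupElt H m * inclA (translationAction H) f =
      inclA _ (translationAction H (.ofAdd m) f) * groupElt H m :=
  u_mul_pi (inclA _) (inclG _) (covariance (translationAction H)) (.ofAdd m) f

variable (s) in
/-- The matrix unit `u_{s i - s j} δ_j` of the crossed product: `δ_j` is the projection at the class
of `s j`, which the unitary carries to the class of `s i`. -/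
def crossedMatrixUnit (i j : ι) : CrossedProduct (translationAction H) :=
  groupElt H (s i - s j) * inclA _ (pointMass (s j))

theorem crossedMatrixUnit_eq (i j : ι) : (crossedMatrixUnit s i j : CrossedProduct
    (translationAction H)) = inclA _ (pointMass (s i)) * groupElt H (s i - s j) := by
  rw [crossedMatrixUnit, groupElt_mul_inclA, translationAction_pointMass, ← QuotientAddGroup.mk_add,
    add_sub_cancel]

include hs in
theorem isMatrixUnits_crossedMatrixUnit [Fintype ι] [DecidableEq ι] :
    IsMatrixUnits (crossedMatrixUnit s : ι → ι → CrossedProduct (translationAction H)) where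
  mul_eq i j l m := by
    rw [crossedMatrixUnit_eq l m, crossedMatrixUnit, mul_assoc, ← mul_assoc (inclA _ _), ← map_mul,
      pointMass_mul hs]
    split_ifs with h
    · subst h
      rw [← crossedMatrixUnit_eq, crossedMatrixUnit, ← mul_assoc, ← groupElt_add,
        sub_add_sub_cancel, crossedMatrixUnit]
    · rw [map_zero, zero_mul, mul_zero]
  star_eq i j := by
    rw [crossedMatrixUnit, star_mul, ← map_star, star_pointMass, star_groupElt, neg_sub,
      crossedMatrixUnit_eq]
  sum_eq := by
    have h := congrArg (inclA (translationAction H)) (sum_smul_pointMass hs 1)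
    rw [map_one, map_sum] at h
    rw [← h]
    refine Finset.sum_congr rfl fun i _ => ?_
    rw [crossedMatrixUnit, sub_self, groupElt_zero, one_mul, ContinuousMap.one_apply, one_smul]

/-- The unitaries `u_h` with `h ∈ H` are central, as `H` acts trivially on `C(F)` and `ℤ^k` is
commutative. -/
theorem commute_groupElt {h : Fin k → ℤ} (hh : h ∈ H) (x : CrossedProduct (translationAction H)) :
    Commute (groupElt H h) x := by
  refine commute_of_generators (fun f => ?_) (fun g => ?_) x
  · have : translationAction H (.ofAdd h) f = f := by
      ext y
      rw [translationAction_apply, toAdd_ofAdd, (QuotientAddGroup.eq_zero_iff h).2 hh, sub_zero]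
    rw [commute_iff_eq, groupElt_mul_inclA, this]
  · change groupElt H h * groupElt H g.toAdd = groupElt H g.toAdd * groupElt H h
    rw [← groupElt_add, ← groupElt_add, add_comm]

/-- The functional calculus of the central unitaries `u_h`, in the coordinates `e` of `H`. -/
theorem exists_central_calculus (e : H ≃+ (Fin k → ℤ)) :
    ∃ ψ : C(Fin k → Circle, ℂ) →⋆ₐ[ℂ] CrossedProduct (translationAction H),
      (∀ f a, Commute (ψ f) a) ∧ ∀ h : H, ψ (torusChar (e h)) = groupElt H h := by
  obtain ⟨ψ, h1, h2⟩ := exists_torus_calculus ((inclG (translationAction H)).comp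
    (AddMonoidHom.toMultiplicative (H.subtype.comp (e.symm : (Fin k → ℤ) →+ H))))
    (fun m a => commute_groupElt (e.symm m.toAdd).2 a)
  refine ⟨ψ, h1, fun h => (h2 (e h)).trans ?_⟩
  change groupElt H (e.symm (e h)) = groupElt H h
  rw [e.symm_apply_apply]

variable [Fintype ι] [DecidableEq ι] (e : H ≃+ (Fin k → ℤ))
  {ψ : C(Fin k → Circle, ℂ) →⋆ₐ[ℂ] CrossedProduct (translationAction H)}
  (hψ : ∀ f a, Commute (ψ f) a) (hψe : ∀ h : H, ψ (torusChar (e h)) = groupElt H h)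

theorem matrixUnitsHom_diagonalHom (f : C((Fin k → ℤ) ⧸ H, ℂ)) :
    matrixUnitsHom ψ hψ (isMatrixUnits_crossedMatrixUnit hs) (diagonalHom s _ f) = inclA _ f := by
  have hc (c : ℂ) : ψ (.const _ c) = c • 1 := by
    rw [← Algebra.algebraMap_eq_smul_one]; exact AlgHomClass.commutes ψ c
  conv_rhs => rw [← sum_smul_pointMass hs f, map_sum]
  rw [matrixUnitsHom_apply]
  refine Finset.sum_congr rfl fun i _ => ?_
  rw [Finset.sum_eq_single i]
  · rw [entry_diagonalHom, if_pos rfl, hc, crossedMatrixUnit, sub_self, groupElt_zero, one_mul,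
      smul_mul_assoc, one_mul, map_smul]
  · intro j _ hj
    rw [entry_diagonalHom, if_neg hj.symm, map_zero, zero_mul]
  · exact fun h => absurd (Finset.mem_univ i) h

include hψe in
theorem matrixUnitsHom_translationMatrix (m : Fin k → ℤ) :
    matrixUnitsHom ψ hψ (isMatrixUnits_crossedMatrixUnit hs) (translationMatrix e s m) =
      groupElt H m := by
  have hE := isMatrixUnits_crossedMatrixUnit hs
  have hm : ∑ j, groupElt H m * crossedMatrixUnit s j j = groupElt H m :=
    (Finset.mul_sum _ _ _).symm.trans
      ((congrArg (groupElt H m * ·) hE.sum_eq).trans (mul_one _))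
  rw [matrixUnitsHom_apply, Finset.sum_comm, ← hm]
  refine Finset.sum_congr rfl fun j _ => ?_
  obtain ⟨i, hi⟩ := exists_sub_mem hs (s j + m)
  rw [Finset.sum_eq_single i]
  · rw [entry_translationMatrix, subgroupChar_of_mem e hi, hψe, crossedMatrixUnit, ← mul_assoc,
      ← groupElt_add, crossedMatrixUnit, ← mul_assoc, ← groupElt_add]
    -- The unitary supplied by the character completes the translation by `s i - s j` to one by `m`.
    have h : s j + m - s i + (s i - s j) = m + (s j - s j) := by abel
    exact congrArg (groupElt H · * _) h
  · intro i' _ hne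
    rw [entry_translationMatrix, subgroupChar_of_notMem, map_zero, zero_mul]
    intro h
    have := H.sub_mem hi h
    rw [sub_sub_sub_cancel_left, sub_mem_iff_eq hs] at this
    exact hne this
  · exact fun h => absurd (Finset.mem_univ i) h

include hψe in
theorem matrixUnitsHom_toMatrixMaps (x : CrossedProduct (translationAction H)) :
    matrixUnitsHom ψ hψ (isMatrixUnits_crossedMatrixUnit hs) (toMatrixMaps e hs x) = x := by
  refine DFunLike.congr_fun ((existsUnique_lift (inclA _) (inclG _)
    (covariance (translationAction H))).unique
    (y₁ := (matrixUnitsHom ψ hψ (isMatrixUnits_crossedMatrixUnit hs)).comp (toMatrixMaps e hs))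
    (y₂ := .id ℂ _) ⟨fun f => ?_, fun g => ?_⟩ ⟨fun _ => rfl, fun _ => rfl⟩) x
  · rw [StarAlgHom.comp_apply, toMatrixMaps_inclA, matrixUnitsHom_diagonalHom hs hψ]
  · rw [StarAlgHom.comp_apply, toMatrixMaps_inclG, matrixUnitsHom_translationMatrix hs e hψ hψe]
    rfl

theorem entry_toMatrixMaps_crossedMatrixUnit (i j a b : ι) :
    entry (toMatrixMaps e hs (crossedMatrixUnit s i j)) a b = if a = i ∧ b = j then 1 else 0 := by
  rw [crossedMatrixUnit, map_mul, groupElt, toMatrixMaps_inclG, toMatrixMaps_inclA, entry_mul,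
    Finset.sum_eq_single b]
  · rw [entry_translationMatrix, entry_diagonalHom, if_pos rfl, pointMass_apply_rep hs]
    by_cases hb : b = j
    · subst hb
      rw [toAdd_ofAdd, add_sub_cancel, subgroupChar_sub e hs]
      simp [eq_comm]
    · simp [hb]
  · intro c _ hc
    rw [entry_diagonalHom, if_neg hc, mul_zero]
  · exact fun h => absurd (Finset.mem_univ b) h

include hψe in
/-- Under `toMatrixMaps`, the functional calculus of the central unitaries becomes the embedding of the
scalar-valued functions. -/
theorem toMatrixMaps_comp_calculus :
    (toMatrixMaps e hs).comp ψ = (scalarMap : _ →⋆ₐ[ℂ] MatrixMaps (Fin k → Circle) ι) := by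
  refine starAlgHom_ext_of_torusChar fun m => ?_
  obtain ⟨h, rfl⟩ := e.surjective m
  rw [StarAlgHom.comp_apply, hψe, groupElt, toMatrixMaps_inclG]
  refine entry_ext fun i j => ?_
  rw [entry_translationMatrix, entry_scalarMap, toAdd_ofAdd, add_sub_right_comm,
    ← subgroupChar_mul e h.2, subgroupChar_sub e hs, subgroupChar_of_mem e h.2, ite_mul, one_mul,
    zero_mul]
  exact if_congr eq_comm rfl rfl

include hψe in
theorem toMatrixMaps_matrixUnitsHom (f : MatrixMaps (Fin k → Circle) ι) :
    toMatrixMaps e hs (matrixUnitsHom ψ hψ (isMatrixUnits_crossedMatrixUnit hs) f) = f := by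
  have hsc (g) : toMatrixMaps e hs (ψ g) = scalarMap g :=
    DFunLike.congr_fun (toMatrixMaps_comp_calculus hs e hψe) g
  refine entry_ext fun a b => ?_
  simp [matrixUnitsHom_apply, hsc, entry_sum, entry_mul, entry_scalarMap,
    entry_toMatrixMaps_crossedMatrixUnit, ite_and]

include hs in
theorem nonempty_starAlgEquiv_matrixMaps (e : H ≃+ (Fin k → ℤ)) :
    Nonempty (CrossedProduct (translationAction H) ≃⋆ₐ[ℂ] MatrixMaps (Fin k → Circle) ι) := by
  obtain ⟨ψ, hψ, hψe⟩ := exists_central_calculus e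
  exact ⟨.ofBijective (toMatrixMaps e hs)
    ⟨Function.LeftInverse.injective (matrixUnitsHom_toMatrixMaps hs e hψ hψe),
      Function.RightInverse.surjective (toMatrixMaps_matrixUnitsHom hs e hψ hψe)⟩⟩

end Inverse

theorem proposition2p8 (k : ℕ) (H : AddSubgroup (Fin k → ℤ)) [Finite ((Fin k → ℤ) ⧸ H)] :
    Nonempty (CrossedProduct (translationAction H) ≃⋆ₐ[ℂ]
      C(Fin k → Circle,
        CStarMatrix (Fin (Nat.card ((Fin k → ℤ) ⧸ H))) (Fin (Nat.card ((Fin k → ℤ) ⧸ H))) ℂ)) := by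
  obtain ⟨e⟩ := Int.addSubgroup_index_ne_zero_iff.1 (AddSubgroup.index_ne_zero_of_finite (H := H))
  let σ := (Finite.equivFin ((Fin k → ℤ) ⧸ H)).symm
  have hs : Function.Bijective fun i => ((σ i).out : (Fin k → ℤ) ⧸ H) := by
    convert σ.bijective using 2 with i
    exact Quotient.out_eq' _
  exact nonempty_starAlgEquiv_matrixMaps hs e
end
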